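/- Let $\beta,\gamma\ge 1$ be integers and let $A\in\mathbb C^{n\times n}$ be banded with upper bandwidth $\beta$ and lower bandwidth $\gamma$, i.e. $(A)_{k,\ell}=0$ whenever $\ell-k>\beta$ or $k-\ell>\gamma$. Assume that all eigenvalues of $A$ have positive real part and that the field of values $W(A)=\{v^*Av : v\in\mathbb C^n,\ \|v\|_2=1\}$ is contained in the closed disk with center $c\in\mathbb C$ and radius $R>0$; put $c_1=\operatorname{Re}c$. Let $\mu:[0,\infty)\to\mathbb R$ be nondecreasing and such that the Laplace–Stieltjes transform $$f(z)=\int_0^\infty e^{-tz}\,d\mu(t)$$ converges for all $z$ with $\operatorname{Re}z>0$. For indices $k,\ell\in\{1,\dots,n\}$ let $\xi=\lceil(\ell-k)/\beta\rceil$ if $k<\ell$ and $\xi=\lceil(k-\ell)/\gamma\rceil$ if $k\ge\ell$. Then the (entrywise) integral defining the matrix function $$f(A)=\int_0^\infty e^{-tA}\,d\mu(t)$$ converges absolutely, and $$|(f(A))_{k,\ell}|\;\le\;2\xi\int_{[0,\xi/R)}\frac{e^{-tc_1}}{\xi-Rt}\left(\frac{eRt}{\xi}\right)^{\xi}d\mu(t)\;+\;\left|\int_{[\xi/R,\infty)}\left(e^{-tA}\right)_{k,\ell}\,d\mu(t)\right|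 .$$ Here the first integral has a nonnegative integrand and may equal $+\infty$ (then the bound is trivial); an atom of $d\mu$ at $t=\xi/R$ is counted in the second integral only, and a jump of $\mu$ at $0$ contributes the atom $\mu(0+)-\mu(0)$. For $k=\ell$ one has $\xi=0$, and the first term is read as $0$. -/

import Mathlib

open scoped ENNReal

noncomputable section

/-- `A` is banded with upper bandwidth `β` and lower bandwidth `γ`:
`A k l = 0` whenever `l - k > β` or `k - l > γ`. -/
def IsBanded {n : ℕ} (β γ : ℕ) (A : Matrix (Fin n) (Fin n) ℂ) : Prop :=
  ∀ k l : Fin n, ((l : ℤ) - (k : ℤ) > (β : ℤ) ∨ (k : ℤ) - (l : ℤ) > (γ : ℤ)) → A k l = 0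

/-- The number `ξ`: `⌈(l - k) / β⌉` if `k < l`, and `⌈(k - l) / γ⌉` if `k ≥ l`. -/
def bandIndex {n : ℕ} (β γ : ℕ) (k l : Fin n) : ℕ :=
  if k < l then ⌈(((l : ℕ) : ℝ) - ((k : ℕ) : ℝ)) / (β : ℝ)⌉₊
  else ⌈(((k : ℕ) : ℝ) - ((l : ℕ) : ℝ)) / (γ : ℝ)⌉₊

/-- The field of values `W(A) = {v* A v : ‖v‖ = 1}`, with the Euclidean norm on `ℂⁿ`. -/
def fieldOfValues {n : ℕ} (A : Matrix (Fin n) (Fin n) ℂ) : Set ℂ :=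
  {z | ∃ v : EuclideanSpace ℂ (Fin n), ‖v‖ = 1 ∧ z = star v.ofLp ⬝ᵥ (A.mulVec v.ofLp)}

/-- A nondecreasing function on `[0, ∞)`, extended by its value at `0` to the negative half-line,
is nondecreasing on `ℝ`. -/
theorem monotone_extend {μ : ℝ → ℝ} (hμ : MonotoneOn μ (Set.Ici 0)) :
    Monotone (fun t : ℝ => μ (max t 0)) := fun a b hab =>
  hμ (le_max_right a 0) (le_max_right b 0) (max_le_max_right 0 hab)

/-- The Lebesgue-Stieltjes measure `dμ` of a nondecreasing function `μ` on `[0, ∞)`. The function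
is extended by `μ(0)` to the left of `0`, so that a jump of `μ` at `0` contributes the atom
`μ(0+) - μ(0)`; `μ` need not be right continuous (`Monotone.stieltjesFunction` is its
right-continuous version, which has the same measure). -/
def lsMeasure (μ : ℝ → ℝ) (hμ : MonotoneOn μ (Set.Ici 0)) : MeasureTheory.Measure ℝ :=
  (monotone_extend hμ).stieltjesFunction.measure

/-- The integral `∫₀^∞ e^{-tz} dμ(t)` defining the Laplace-Stieltjes transform converges
at the point `z`. -/
def LaplaceStieltjesConverges (μ : ℝ → ℝ) (hμ : MonotoneOn μ (Set.Ici 0)) (z : ℂ) : Prop :=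
  MeasureTheory.IntegrableOn (fun t : ℝ => Complex.exp (-(t : ℂ) * z)) (Set.Ici 0)
    (lsMeasure μ hμ)

/-- The entry `(e^{-tA})_{k,l}`. -/
def expEntry {n : ℕ} (A : Matrix (Fin n) (Fin n) ℂ) (k l : Fin n) (t : ℝ) : ℂ :=
  (NormedSpace.exp ((-(t : ℂ)) • A)) k l

/-- The matrix function `f(A) = ∫₀^∞ e^{-tA} dμ(t)` attached to the Laplace-Stieltjes transform
`f(z) = ∫₀^∞ e^{-tz} dμ(t)` (integral taken entrywise). -/
def laplaceStieltjesMatrix {n : ℕ} (μ : ℝ → ℝ) (hμ : MonotoneOn μ (Set.Ici 0))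
    (A : Matrix (Fin n) (Fin n) ℂ) : Matrix (Fin n) (Fin n) ℂ :=
  Matrix.of fun k l => ∫ t in Set.Ici (0 : ℝ), expEntry A k l t ∂(lsMeasure μ hμ)

end

/-! Split the integral at `t = ξ / R`. Below it, expand `e^{-tA} = e^{-tc} ∑ (-t)^j (A - c)^j / j!`.
Bandedness kills the `(k, l)` entry of the terms `j < ξ`. For the others, `(A - c) / R` has
numerical radius at most one, hence so do its powers (Berger); polarization turns this into an entry
bound `2 * R ^ j`, with no normality assumed. Since `ξ ^ ξ ≤ e ^ ξ * ξ!`, a geometric series of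
ratio `R * t / ξ` dominates the tail. Absolute convergence needs a separate argument, since `Re c`
need not be positive: on generalized eigenvectors `e^{-tA}` is a finite sum of terms `t ^ p *
e^{-tz}` with `z` an eigenvalue. -/

open scoped InnerProductSpace in
/-- If the numerical radius of `T` is at most one, then `Re ⟪x, T ^ N x⟫ ≤ ‖x‖²`. -/
theorem re_inner_pow_le_of_numericalRadius_le_one {E : Type*} [NormedAddCommGroup E]
    [InnerProductSpace ℂ E] (T : Module.End ℂ E) (hT : ∀ x, ‖⟪x, T x⟫_ℂ‖ ≤ ‖x‖ ^ 2)
    {N : ℕ} (hN : N ≠ 0) (x : E) : (⟪x, (T ^ N) x⟫_ℂ).re ≤ ‖x‖ ^ 2 := by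
  obtain ⟨ω, hω⟩ : ∃ ω : ℂ, IsPrimitiveRoot ω N := ⟨_, Complex.isPrimitiveRoot_exp N hN⟩
  -- The `S j` average to the identity over the `N`-th roots of unity, so `⟪x, (1 - T ^ N) x⟫` is
  -- the mean of the `⟪S j x, (1 - ω ^ j T) (S j x)⟫` (up to conjugation), each of nonnegative real
  -- part.
  set S : ℕ → Module.End ℂ E := fun j => ∑ m ∈ Finset.range N, (ω ^ j • T) ^ m with hS
  have hpow (j : ℕ) : (ω ^ j • T) ^ N = T ^ N := by
    rw [smul_pow, ← pow_mul, mul_comm, pow_mul, hω.pow_eq_one, one_pow, one_smul]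
  have hfac (j : ℕ) : (1 - ω ^ j • T) * S j = 1 - T ^ N := by
    rw [hS, mul_neg_geom_sum, hpow]
  have hsum : ∑ j ∈ Finset.range N, S j = (N : ℂ) • (1 : Module.End ℂ E) := by
    rw [hS, Finset.sum_comm, Finset.sum_eq_single_of_mem 0 (by simpa using Nat.pos_of_ne_zero hN)]
    · ext y; simp [Nat.cast_smul_eq_nsmul ℂ]
    · intro m hm hm0
      have h1 : ω ^ m ≠ 1 := hω.pow_ne_one_of_pos_of_lt hm0 (Finset.mem_range.1 hm)
      have h2 := mul_neg_geom_sum (ω ^ m) N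
      rw [← pow_mul, mul_comm m, pow_mul, hω.pow_eq_one, one_pow, sub_self] at h2
      have h3 := (mul_eq_zero.1 h2).resolve_left (sub_ne_zero.2 h1.symm)
      simp_rw [smul_pow, ← Finset.sum_smul]
      rw [show ∑ i ∈ Finset.range N, (ω ^ i) ^ m = ∑ i ∈ Finset.range N, (ω ^ m) ^ i from
        Finset.sum_congr rfl fun i _ => pow_right_comm ω i m, h3, zero_smul]
  have hω1 : ‖ω‖ = 1 := hω.norm'_eq_one hN
  have hterm (j : ℕ) : 0 ≤ (⟪S j x, x - (T ^ N) x⟫_ℂ).re := by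
    have h1 : x - (T ^ N) x = S j x - ω ^ j • T (S j x) := by
      simpa using (LinearMap.congr_fun (hfac j) x).symm
    rw [h1, inner_sub_right, inner_smul_right, Complex.sub_re, sub_nonneg]
    calc (ω ^ j * ⟪S j x, T (S j x)⟫_ℂ).re ≤ ‖ω ^ j * ⟪S j x, T (S j x)⟫_ℂ‖ :=
          Complex.re_le_norm _
      _ = ‖⟪S j x, T (S j x)⟫_ℂ‖ := by simp [hω1]
      _ ≤ ‖S j x‖ ^ 2 := hT _
      _ = (⟪S j x, S j x⟫_ℂ).re := by
        rw [inner_self_eq_norm_sq_to_K]; norm_cast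
  have htot : 0 ≤ (N : ℝ) * (‖x‖ ^ 2 - (⟪x, (T ^ N) x⟫_ℂ).re) := by
    have h := Finset.sum_nonneg fun j (_ : j ∈ Finset.range N) => hterm j
    rw [← Complex.re_sum, ← sum_inner, ← LinearMap.sum_apply, hsum, LinearMap.smul_apply,
      Module.End.one_apply, inner_smul_left, inner_sub_right, inner_self_eq_norm_sq_to_K] at h
    refine h.trans_eq ?_
    rw [Complex.conj_natCast, ← Complex.ofReal_natCast, Complex.re_ofReal_mul, Complex.sub_re]
    norm_cast
  have hN' : (0 : ℝ) < N := by exact_mod_cast Nat.pos_of_ne_zero hN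
  linarith [nonneg_of_mul_nonneg_right htot hN']

open scoped InnerProductSpace in
/-- **Berger's power inequality** for numerical radii. -/
theorem norm_inner_pow_le_of_numericalRadius_le_one {E : Type*} [NormedAddCommGroup E]
    [InnerProductSpace ℂ E] (T : Module.End ℂ E) (hT : ∀ x, ‖⟪x, T x⟫_ℂ‖ ≤ ‖x‖ ^ 2)
    (N : ℕ) (x : E) : ‖⟪x, (T ^ N) x⟫_ℂ‖ ≤ ‖x‖ ^ 2 := by
  rcases eq_or_ne N 0 with rfl | hN
  · rw [pow_zero, Module.End.one_apply, inner_self_eq_norm_sq_to_K]; simp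
  -- Replacing `T` by `v • T` with `v ^ N = u` rotates the inner product onto the nonnegative reals.
  obtain ⟨u, hu, hux⟩ : ∃ u : ℂ, ‖u‖ = 1 ∧ u * ⟪x, (T ^ N) x⟫_ℂ = ‖⟪x, (T ^ N) x⟫_ℂ‖ := by
    set w := ⟪x, (T ^ N) x⟫_ℂ
    rcases eq_or_ne w 0 with hw | hw
    · exact ⟨1, by simp, by simp [hw]⟩
    · have : (‖w‖ : ℂ) ≠ 0 := by exact_mod_cast norm_ne_zero_iff.2 hw
      exact ⟨‖w‖ / w, by simp [norm_ne_zero_iff.2 hw], by field_simp⟩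
  obtain ⟨v, rfl⟩ := IsAlgClosed.exists_pow_nat_eq u (Nat.pos_of_ne_zero hN)
  have hv : ‖v‖ = 1 := by
    rw [norm_pow] at hu
    exact (pow_eq_one_iff_of_nonneg (norm_nonneg v) hN).1 hu
  have h := re_inner_pow_le_of_numericalRadius_le_one (v • T)
    (fun y => by simpa [inner_smul_right, hv] using hT y) hN x
  rw [smul_pow, LinearMap.smul_apply, inner_smul_right, hux, Complex.ofReal_re] at h
  exact h

open scoped InnerProductSpace in
/-- The sesquilinear form of an operator of numerical radius at most one is bounded by `2`. -/
theorem norm_inner_le_two_of_numericalRadius_le_one {E : Type*} [NormedAddCommGroup E]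
    [InnerProductSpace ℂ E] (T : Module.End ℂ E) (hT : ∀ x, ‖⟪x, T x⟫_ℂ‖ ≤ ‖x‖ ^ 2)
    {x y : E} (hx : ‖x‖ = 1) (hy : ‖y‖ = 1) : ‖⟪x, T y⟫_ℂ‖ ≤ 2 := by
  -- By the parallelogram law the four squared norms sum to `8`; dividing by `4` gives the constant
  -- `2`.
  have hpol : 4 * ⟪x, T y⟫_ℂ = ⟪x + y, T (x + y)⟫_ℂ - ⟪x - y, T (x - y)⟫_ℂ
      - Complex.I * ⟪x + Complex.I • y, T (x + Complex.I • y)⟫_ℂ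
      + Complex.I * ⟪x - Complex.I • y, T (x - Complex.I • y)⟫_ℂ := by
    simp only [map_add, map_sub, map_smul, inner_add_left, inner_add_right, inner_sub_left,
      inner_sub_right, inner_smul_left, inner_smul_right, Complex.conj_I]
    linear_combination (2 * ⟪x, T y⟫_ℂ - 2 * ⟪y, T x⟫_ℂ) * Complex.I_sq
  have h1 := parallelogram_law_with_norm ℂ x y
  have h2 := parallelogram_law_with_norm ℂ x (Complex.I • y)
  rw [norm_smul, Complex.norm_I, one_mul] at h2
  rw [hx, hy] at h1 h2
  have h4 : ‖4 * ⟪x, T y⟫_ℂ‖ ≤ ‖x + y‖ ^ 2 + ‖x - y‖ ^ 2 + ‖x + Complex.I • y‖ ^ 2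
      + ‖x - Complex.I • y‖ ^ 2 := by
    rw [hpol]
    refine (norm_add_le _ _).trans (add_le_add ((norm_sub_le _ _).trans
      (add_le_add ((norm_sub_le _ _).trans (add_le_add (hT _) (hT _))) ?_)) ?_)
    · simpa using hT (x + Complex.I • y)
    · simpa using hT (x - Complex.I • y)
  rw [norm_mul, Complex.norm_ofNat] at h4
  nlinarith

open scoped InnerProductSpace in
/-- If the field of values of `A` lies in the disk of center `c` and radius `R`, then the entries
of `(A - c) ^ N` are bounded by `2 * R ^ N`. -/
theorem norm_entry_sub_smul_pow_le {n : ℕ} {A : Matrix (Fin n) (Fin n) ℂ} {c : ℂ} {R : ℝ}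
    (hR : 0 < R) (hW : fieldOfValues A ⊆ Metric.closedBall c R) (N : ℕ) (k l : Fin n) :
    ‖((A - c • (1 : Matrix (Fin n) (Fin n) ℂ)) ^ N) k l‖ ≤ 2 * R ^ N := by
  set B := A - c • (1 : Matrix (Fin n) (Fin n) ℂ) with hB
  set T : Module.End ℂ (EuclideanSpace ℂ (Fin n)) := Matrix.toEuclideanLin ((R : ℂ)⁻¹ • B) with hT
  have hunit (v : EuclideanSpace ℂ (Fin n)) (hv : ‖v‖ = 1) : ‖⟪v, T v⟫_ℂ‖ ≤ 1 := by
    have h1 := hW ⟨v, hv, rfl⟩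
    rw [Metric.mem_closedBall, dist_eq_norm] at h1
    have h2 : star v.ofLp ⬝ᵥ v.ofLp = 1 := by
      rw [dotProduct_comm, ← EuclideanSpace.inner_eq_star_dotProduct, inner_self_eq_norm_sq_to_K,
        hv]
      simp
    have h3 : ⟪v, T v⟫_ℂ = (R : ℂ)⁻¹ * (star v.ofLp ⬝ᵥ A.mulVec v.ofLp - c) := by
      rw [EuclideanSpace.inner_eq_star_dotProduct, dotProduct_comm, hT, Matrix.ofLp_toLpLin,
        Matrix.toLin'_apply, Matrix.smul_mulVec, dotProduct_smul, hB, Matrix.sub_mulVec,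
        Matrix.smul_mulVec, Matrix.one_mulVec, dotProduct_sub, dotProduct_smul, h2, smul_eq_mul,
        smul_eq_mul, mul_one]
    rw [h3, norm_mul, norm_inv, Complex.norm_real, Real.norm_of_nonneg hR.le]
    exact inv_mul_le_one_of_le₀ h1 hR.le
  have hball (v : EuclideanSpace ℂ (Fin n)) : ‖⟪v, T v⟫_ℂ‖ ≤ ‖v‖ ^ 2 := by
    rcases eq_or_ne v 0 with rfl | hv
    · simp
    have hv' : ‖v‖ ≠ 0 := norm_ne_zero_iff.2 hv
    have h1 := hunit ((‖v‖⁻¹ : ℂ) • v) (by simp [norm_smul, hv'])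
    rw [map_smul, inner_smul_left, inner_smul_right, norm_mul, norm_mul] at h1
    simp only [map_inv₀, Complex.conj_ofReal, norm_inv, Complex.norm_real, norm_norm] at h1
    rw [← mul_assoc, ← mul_inv, inv_mul_le_iff₀ (by positivity)] at h1
    linarith [sq ‖v‖]
  have hmain := norm_inner_le_two_of_numericalRadius_le_one (T ^ N)
    (norm_inner_pow_le_of_numericalRadius_le_one T hball N)
    (x := EuclideanSpace.single k 1) (y := EuclideanSpace.single l 1) (by simp) (by simp)
  have hentry : ⟪EuclideanSpace.single k (1 : ℂ), (T ^ N) (EuclideanSpace.single l 1)⟫_ℂ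
      = ((R : ℂ) ^ N)⁻¹ * (B ^ N) k l := by
    rw [EuclideanSpace.inner_single_left, hT, ← Matrix.toLpLin_pow, smul_pow, Matrix.ofLp_toLpLin,
      Matrix.toLin'_apply]
    simp
  rw [hentry, norm_mul, norm_inv, norm_pow, Complex.norm_real, Real.norm_of_nonneg hR.le,
    inv_mul_le_iff₀ (by positivity)] at hmain
  linarith

/-! ### Powers of banded matrices. -/

/-- The powers of a banded matrix are banded. -/
theorem IsBanded.pow {n : ℕ} {β γ : ℕ} {A : Matrix (Fin n) (Fin n) ℂ} (hA : IsBanded β γ A)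
    (N : ℕ) : IsBanded (N * β) (N * γ) (A ^ N) := by
  induction N with
  | zero =>
    intro k l h
    rw [pow_zero]
    refine Matrix.one_apply_ne ?_
    rintro rfl
    simp at h
  | succ N ih =>
    intro k l h
    rw [pow_succ, Matrix.mul_apply]
    refine Finset.sum_eq_zero fun m _ => ?_
    push_cast at h
    by_cases h1 : (m : ℤ) - k > (N * β : ℕ) ∨ (k : ℤ) - m > (N * γ : ℕ)
    · rw [ih k m h1, zero_mul]
    · rw [hA m l, mul_zero]
      push_cast [not_or, not_lt] at h1
      rcases h with h | h
      · left; linarith [h1.1]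
      · right; linarith [h1.2]

/-- Subtracting a multiple of the identity keeps a matrix banded. -/
theorem IsBanded.sub_smul_one {n : ℕ} {β γ : ℕ} {A : Matrix (Fin n) (Fin n) ℂ}
    (hA : IsBanded β γ A) (c : ℂ) : IsBanded β γ (A - c • (1 : Matrix (Fin n) (Fin n) ℂ)) := by
  intro k l h
  have hkl : k ≠ l := by
    rintro rfl
    omega
  simp [hA k l h, Matrix.one_apply_ne hkl]

/-- The entry `(k, l)` of the power `A ^ N` of a banded matrix vanishes for `N < ξ`. -/
theorem IsBanded.pow_apply_eq_zero_of_lt_bandIndex {n : ℕ} {β γ : ℕ} (hβ : 0 < β) (hγ : 0 < γ)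
    {A : Matrix (Fin n) (Fin n) ℂ} (hA : IsBanded β γ A) {k l : Fin n} {N : ℕ}
    (hN : N < bandIndex β γ k l) : (A ^ N) k l = 0 := by
  have hβ' : (0 : ℝ) < β := by exact_mod_cast hβ
  have hγ' : (0 : ℝ) < γ := by exact_mod_cast hγ
  refine hA.pow N k l ?_
  unfold bandIndex at hN
  split_ifs at hN
  · left
    rw [Nat.lt_ceil, lt_div_iff₀ hβ'] at hN
    exact_mod_cast hN
  · right
    rw [Nat.lt_ceil, lt_div_iff₀ hγ'] at hN
    exact_mod_cast hN

/-! ### Pointwise decay of the entries of the exponential. -/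

/-- The expansion of the entries of `e^{-tA}` around the scalar matrix `z`. -/
theorem hasSum_expEntry {n : ℕ} (A : Matrix (Fin n) (Fin n) ℂ) (z : ℂ) (k l : Fin n) (t : ℝ) :
    HasSum (fun j : ℕ => Complex.exp (-(t : ℂ) * z) * ((j.factorial : ℂ)⁻¹ * ((-(t : ℂ)) ^ j *
      ((A - z • (1 : Matrix (Fin n) (Fin n) ℂ)) ^ j) k l))) (expEntry A k l t) := by
  -- Any algebra norm would do: it only serves the convergence of the exponential series.
  let _ := Matrix.linftyOpNormedRing (n := Fin n) (α := ℂ)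
  let _ := Matrix.linftyOpNormedAlgebra (n := Fin n) (R := ℂ) (α := ℂ)
  set B := A - z • (1 : Matrix (Fin n) (Fin n) ℂ) with hB
  have hsplit : (-(t : ℂ)) • A = algebraMap ℂ _ (-(t : ℂ) * z) + (-(t : ℂ)) • B := by
    rw [Algebra.algebraMap_eq_smul_one, hB, smul_sub, smul_smul]
    abel
  have hexp : NormedSpace.exp ((-(t : ℂ)) • A) =
      Complex.exp (-(t : ℂ) * z) • NormedSpace.exp ((-(t : ℂ)) • B) := by
    rw [hsplit, Matrix.exp_add_of_commute _ _ (Algebra.commute_algebraMap_left _ _), Complex.exp_eq_exp_ℂ,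
      Algebra.smul_def (NormedSpace.exp (-(t : ℂ) * z))]
    exact congrArg (· * NormedSpace.exp ((-(t : ℂ)) • B))
      (NormedSpace.algebraMap_exp_comm (𝔸 := Matrix (Fin n) (Fin n) ℂ) (-(t : ℂ) * z)).symm
  have hs := NormedSpace.exp_series_hasSum_exp' (𝕂 := ℂ) ((-(t : ℂ)) • B)
  have hs' := (Pi.hasSum.1 (Pi.hasSum.1 hs k) l).mul_left (Complex.exp (-(t : ℂ) * z))
  unfold expEntry
  rw [hexp, Matrix.smul_apply, smul_eq_mul]
  refine hs'.congr_fun fun j => ?_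
  rw [smul_pow]
  simp

/-- A geometric bound for the tail terms of the exponential series. -/
theorem inv_factorial_mul_pow_le {x : ℝ} (hx : 0 ≤ x) {ξ : ℕ} (hξ0 : (0 : ℝ) < ξ) (i : ℕ) :
    ((i + ξ).factorial : ℝ)⁻¹ * x ^ (i + ξ) ≤ (Real.exp 1 * x / ξ) ^ ξ * (x / ξ) ^ i := by
  have hstir : (ξ : ℝ) ^ ξ ≤ Real.exp 1 ^ ξ * ξ.factorial := by
    -- A single term of the series of `e ^ ξ`.
    have h := Real.pow_div_factorial_le_exp _ hξ0.le ξ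
    rw [div_le_iff₀ (by positivity)] at h
    rwa [← Real.exp_nat_mul, mul_one]
  have hfact : (ξ.factorial : ℝ) * (ξ : ℝ) ^ i ≤ (i + ξ).factorial := by
    have h : ξ.factorial * ξ ^ i ≤ (i + ξ).factorial := by
      rw [add_comm i]
      exact (Nat.mul_le_mul_left _ (Nat.pow_le_pow_left ξ.le_succ i)).trans
        Nat.factorial_mul_pow_le_factorial
    exact_mod_cast h
  rw [inv_mul_le_iff₀ (by positivity), div_pow, div_pow, mul_pow, div_mul_div_comm,
    mul_div_assoc', le_div_iff₀ (by positivity), pow_add]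
  have h1 : (ξ : ℝ) ^ ξ * (ξ : ℝ) ^ i ≤ (i + ξ).factorial * Real.exp 1 ^ ξ :=
    calc (ξ : ℝ) ^ ξ * (ξ : ℝ) ^ i ≤ Real.exp 1 ^ ξ * ξ.factorial * (ξ : ℝ) ^ i := by gcongr
      _ = Real.exp 1 ^ ξ * (ξ.factorial * (ξ : ℝ) ^ i) := by ring
      _ ≤ Real.exp 1 ^ ξ * (i + ξ).factorial := by gcongr
      _ = _ := mul_comm _ _
  calc x ^ i * x ^ ξ * ((ξ : ℝ) ^ ξ * (ξ : ℝ) ^ i)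
      ≤ x ^ i * x ^ ξ * ((i + ξ).factorial * Real.exp 1 ^ ξ) := by gcongr
    _ = _ := by ring

/-- The bound for the entries of `e^{-tA}` with `R * t < ξ`. -/
theorem norm_expEntry_le {n : ℕ} {β γ : ℕ} (hβ : 0 < β) (hγ : 0 < γ)
    {A : Matrix (Fin n) (Fin n) ℂ} (hA : IsBanded β γ A) {c : ℂ} {R : ℝ}
    (hR : 0 < R) (hW : fieldOfValues A ⊆ Metric.closedBall c R) {k l : Fin n} {ξ : ℕ}
    (hξ : ξ = bandIndex β γ k l) {t : ℝ} (ht : 0 ≤ t) (htξ : R * t < ξ) :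
    ‖expEntry A k l t‖ ≤ 2 * ξ * (Real.exp (-t * c.re) / (ξ - R * t) *
      (Real.exp 1 * R * t / ξ) ^ ξ) := by
  have hx : 0 ≤ R * t := by positivity
  -- The strict inequality `R * t < ξ` excludes the diagonal case `ξ = 0`.
  have hξ0 : (0 : ℝ) < ξ := hx.trans_lt htξ
  set x := R * t with hxdef
  have hs := (hasSum_nat_add_iff' ξ).2 (hasSum_expEntry A c k l t)
  rw [Finset.sum_eq_zero (fun j hj => by
    rw [(hA.sub_smul_one c).pow_apply_eq_zero_of_lt_bandIndex hβ hγ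
      (hξ ▸ Finset.mem_range.1 hj)]; simp), sub_zero] at hs
  have hgeom := (hasSum_geometric_of_lt_one (div_nonneg hx hξ0.le)
    ((div_lt_one hξ0).2 htξ)).mul_left
      (2 * Real.exp (-t * c.re) * (Real.exp 1 * x / ξ) ^ ξ)
  refine (hs.norm_le_of_bounded hgeom fun i => ?_).trans_eq ?_
  · have hnorm : ‖Complex.exp (-(t : ℂ) * c)‖ = Real.exp (-t * c.re) := by
      simp [Complex.norm_exp]
    rw [norm_mul, norm_mul, norm_mul, norm_inv, norm_pow, norm_neg, Complex.norm_real,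
      Real.norm_of_nonneg ht, Complex.norm_natCast, hnorm]
    calc _ ≤ Real.exp (-t * c.re) * (((i + ξ).factorial : ℝ)⁻¹ *
          (t ^ (i + ξ) * (2 * R ^ (i + ξ)))) := by
          gcongr
          exact norm_entry_sub_smul_pow_le hR hW _ k l
      _ = 2 * Real.exp (-t * c.re) * (((i + ξ).factorial : ℝ)⁻¹ * x ^ (i + ξ)) := by
          rw [hxdef, mul_pow]; ring
      _ ≤ 2 * Real.exp (-t * c.re) * ((Real.exp 1 * x / ξ) ^ ξ * (x / ξ) ^ i) :=
          mul_le_mul_of_nonneg_left (inv_factorial_mul_pow_le hx hξ0 i) (by positivity)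
      _ = _ := by ring
  · have h1 : (ξ : ℝ) - x ≠ 0 := (sub_pos.2 htξ).ne'
    have h2 : (1 - x / ξ)⁻¹ = ξ / (ξ - x) := by
      rw [one_sub_div hξ0.ne', inv_div]
    rw [h2, hxdef, mul_assoc (Real.exp 1) R t]
    ring

/-! ### Absolute convergence of the matrix integral. -/

open MeasureTheory in
/-- Convergence of the Laplace-Stieltjes integrals gives that of their derivatives. -/
theorem integrableOn_pow_mul_exp {μ : ℝ → ℝ} {hμ : MonotoneOn μ (Set.Ici 0)}
    (hf : ∀ z : ℂ, 0 < z.re → LaplaceStieltjesConverges μ hμ z) {z : ℂ} (hz : 0 < z.re) (j : ℕ) :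
    IntegrableOn (fun t : ℝ => Complex.exp (-(t : ℂ) * z) * (-(t : ℂ)) ^ j) (Set.Ici 0)
      (lsMeasure μ hμ) := by
  -- Half of the decay rate absorbs `t ^ j`; the other half keeps the integral convergent.
  have hd : 0 < z.re / 2 := by positivity
  have h := (hf ((z.re / 2 : ℝ) : ℂ) (by simpa using hd)).norm.const_mul
    (j.factorial / (z.re / 2) ^ j)
  refine h.mono' (by fun_prop) ?_
  filter_upwards [ae_restrict_mem measurableSet_Ici] with t ht
  have ht : 0 ≤ t := ht
  have h1 := Real.pow_div_factorial_le_exp _ (mul_nonneg ht hd.le) j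
  rw [div_le_iff₀ (by positivity), mul_pow] at h1
  have h2 : Real.exp (-t * z.re) = Real.exp (-t * (z.re / 2)) * Real.exp (-t * (z.re / 2)) := by
    rw [← Real.exp_add]; ring_nf
  have h3 : Real.exp (-t * (z.re / 2)) * Real.exp (t * (z.re / 2)) = 1 := by
    rw [← Real.exp_add]; simp
  have hn1 : ‖Complex.exp (-(t : ℂ) * z)‖ = Real.exp (-t * z.re) := by simp [Complex.norm_exp]
  have hn2 : ‖Complex.exp (-(t : ℂ) * ((z.re / 2 : ℝ) : ℂ))‖ = Real.exp (-t * (z.re / 2)) := by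
    simp [Complex.norm_exp]
  rw [norm_mul, norm_pow, norm_neg, Complex.norm_real, Real.norm_of_nonneg ht, hn1, hn2, h2,
    div_mul_eq_mul_div, le_div_iff₀ (by positivity)]
  calc _ = Real.exp (-t * (z.re / 2)) * Real.exp (-t * (z.re / 2)) * (t ^ j * (z.re / 2) ^ j) := by
        ring
    _ ≤ Real.exp (-t * (z.re / 2)) * Real.exp (-t * (z.re / 2)) *
        (Real.exp (t * (z.re / 2)) * j.factorial) := by gcongr
    _ = j.factorial * Real.exp (-t * (z.re / 2)) *
        (Real.exp (-t * (z.re / 2)) * Real.exp (t * (z.re / 2))) := by ring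
    _ = _ := by rw [h3, mul_one]

open MeasureTheory in
/-- The entries of `e^{-tA}` are integrable if the spectrum of `A` lies in the right half-plane. -/
theorem integrableOn_expEntry {n : ℕ} {μ : ℝ → ℝ} {hμ : MonotoneOn μ (Set.Ici 0)}
    (hf : ∀ z : ℂ, 0 < z.re → LaplaceStieltjesConverges μ hμ z)
    {A : Matrix (Fin n) (Fin n) ℂ} (hspec : ∀ z ∈ spectrum ℂ A, 0 < z.re) (i j : Fin n) :
    IntegrableOn (expEntry A i j) (Set.Ici 0) (lsMeasure μ hμ) := by
  -- Passing from entries to vectors makes the claim linear in `v`, so generalized eigenvectors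
  -- suffice.
  suffices hv : ∀ v : Fin n → ℂ,
      IntegrableOn (fun t => ∑ m, expEntry A i m t * v m) (Set.Ici 0) (lsMeasure μ hμ) by
    simpa [Pi.single_apply] using hv (Pi.single j 1)
  intro v
  have hmem : v ∈ ⨆ z, Module.End.maxGenEigenspace (Matrix.toLin' A) z := by
    rw [Module.End.iSup_maxGenEigenspace_eq_top]; trivial
  refine Submodule.iSup_induction _ (motive := fun v : Fin n → ℂ => IntegrableOn
    (fun t => ∑ m, expEntry A i m t * v m) (Set.Ici 0) (lsMeasure μ hμ)) hmem
    (fun z v hv => ?_) (by simp) (fun x y hx hy => ?_)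
  swap
  · refine (hx.add hy).congr (.of_forall fun t => ?_)
    simp [mul_add, Finset.sum_add_distrib]
  · obtain ⟨N, hN⟩ := (Module.End.mem_maxGenEigenspace _ _ _).1 hv
    set B := A - z • (1 : Matrix (Fin n) (Fin n) ℂ) with hB
    have hBlin : Matrix.toLin' A - z • (1 : Module.End ℂ (Fin n → ℂ)) = Matrix.toLin' B := by
      rw [hB, map_sub, map_smul, Matrix.toLin'_one]; rfl
    rw [hBlin, ← Matrix.toLin'_pow, Matrix.toLin'_apply] at hN
    by_cases hz : z ∈ spectrum ℂ A
    · have hzero (m : ℕ) (hm : N ≤ m) : (B ^ m).mulVec v = 0 := by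
        rw [← Nat.sub_add_cancel hm, pow_add, ← Matrix.mulVec_mulVec, hN, Matrix.mulVec_zero]
      have hEq (t : ℝ) : ∑ m, expEntry A i m t * v m = ∑ p ∈ Finset.range N,
          (Complex.exp (-(t : ℂ) * z) * (-(t : ℂ)) ^ p) *
            ((p.factorial : ℂ)⁻¹ * (B ^ p).mulVec v i) := by
        have h1 := hasSum_sum (s := Finset.univ)
          fun m (_ : m ∈ Finset.univ) => (hasSum_expEntry A z i m t).mul_right (v m)
        have h2 : HasSum (fun p : ℕ => (Complex.exp (-(t : ℂ) * z) * (-(t : ℂ)) ^ p) *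
            ((p.factorial : ℂ)⁻¹ * (B ^ p).mulVec v i)) (∑ m, expEntry A i m t * v m) := by
          refine h1.congr_fun fun p => ?_
          rw [Matrix.mulVec, dotProduct, Finset.mul_sum, Finset.mul_sum]
          exact Finset.sum_congr rfl fun m _ => by ring
        refine h2.unique (hasSum_sum_of_ne_finset_zero fun p hp => ?_)
        rw [hzero p (by simpa using hp)]
        simp
      simp_rw [hEq]
      exact integrable_finsetSum _ fun p _ =>
        (integrableOn_pow_mul_exp hf (hspec z hz) p).mul_const _
    -- Off the spectrum the generalized eigenspace is zero.
    · have hu : IsUnit B := by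
        rw [spectrum.notMem_iff, Algebra.algebraMap_eq_smul_one, ← IsUnit.neg_iff, neg_sub] at hz
        exact hz
      obtain ⟨U, hU⟩ := hu.pow N
      have hv0 : v = 0 := by
        rw [← Matrix.one_mulVec v, ← U.inv_mul, ← Matrix.mulVec_mulVec, hU, hN, Matrix.mulVec_zero]
      simp [hv0]

/-! ### Splitting the integral. -/

open MeasureTheory in
theorem theorem3p6 {n : ℕ} (β γ : ℕ) (hβ : 0 < β) (hγ : 0 < γ)
    (μ : ℝ → ℝ) (hμ : MonotoneOn μ (Set.Ici 0))
    (hf : ∀ z : ℂ, 0 < z.re → LaplaceStieltjesConverges μ hμ z)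
    (A : Matrix (Fin n) (Fin n) ℂ) (hband : IsBanded β γ A)
    (hspec : ∀ z ∈ spectrum ℂ A, 0 < z.re)
    (c : ℂ) (R : ℝ) (hR : 0 < R) (hW : fieldOfValues A ⊆ Metric.closedBall c R)
    (k l : Fin n) (ξ : ℕ) (hξ : ξ = bandIndex β γ k l) :
    (∀ i j : Fin n,
      MeasureTheory.IntegrableOn (expEntry A i j) (Set.Ici 0) (lsMeasure μ hμ)) ∧
    ‖laplaceStieltjesMatrix μ hμ A k l‖ₑ ≤
      2 * (ξ : ℝ≥0∞) * (∫⁻ t in Set.Ico (0 : ℝ) (ξ / R),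
        ENNReal.ofReal (Real.exp (-t * c.re) / (ξ - R * t) *
          (Real.exp 1 * R * t / ξ) ^ ξ) ∂(lsMeasure μ hμ)) +
      ‖∫ t in Set.Ici ((ξ : ℝ) / R), expEntry A k l t ∂(lsMeasure μ hμ)‖ₑ := by
  refine ⟨integrableOn_expEntry hf hspec, ?_⟩
  have hint := integrableOn_expEntry hf hspec k l
  -- For `ξ = 0` the interval `Set.Ico 0 (ξ / R)` is empty, so the first term vanishes.
  have h0 : (0 : ℝ) ≤ ξ / R := by positivity
  have hdisj : Disjoint (Set.Ico (0 : ℝ) (ξ / R)) (Set.Ici (ξ / R)) :=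
    Set.disjoint_left.2 fun t ht ht' => not_le.2 ht.2 ht'
  rw [laplaceStieltjesMatrix, Matrix.of_apply, ← Set.Ico_union_Ici_eq_Ici h0,
    setIntegral_union hdisj measurableSet_Ici (hint.mono_set Set.Ico_subset_Ici_self)
      (hint.mono_set (Set.Ici_subset_Ici.2 h0))]
  refine (enorm_add_le _ _).trans (add_le_add_left ?_ _)
  refine (enorm_integral_le_lintegral_enorm _).trans ?_
  rw [← lintegral_const_mul' _ _ (ENNReal.mul_ne_top (by simp) (by simp))]
  refine setLIntegral_mono' measurableSet_Ico fun t ht => ?_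
  have htξ : R * t < ξ := by
    have := (lt_div_iff₀ hR).1 ht.2
    linarith
  have hb := norm_expEntry_le hβ hγ hband hR hW hξ ht.1 htξ
  rw [← ofReal_norm]
  refine (ENNReal.ofReal_le_ofReal hb).trans_eq ?_
  rw [ENNReal.ofReal_mul (by positivity), ENNReal.ofReal_mul (by norm_num)]
  simp
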